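/- Let $\alpha,\beta,\gamma,\delta$ be real numbers with $\alpha>0$, $\delta>0$, and assume $$(H)\qquad \max(\beta,\gamma)\ge 0\quad\text{or}\quad \beta\gamma<\alpha\delta .$$ A solution starting at $(x_0,y_0)\in[0,\infty)^2$ is a pair of continuous functions $x,y:[0,\infty)\to[0,\infty)$ such that for every $t\ge 0$ the sets $\{s\in[0,t]:x(s)=0\}$ and $\{s\in[0,t]:y(s)=0\}$ have Lebesgue measure zero, $\int_0^t \mathbf 1_{\{x(s)>0\}}\frac{ds}{x(s)}<\infty$, $\int_0^t \mathbf 1_{\{y(s)>0\}}\frac{ds}{y(s)}<\infty$, and $$x(t)=x_0+\alpha\int_0^t\frac{ds}{x(s)}+\beta\int_0^t\frac{ds}{y(s)},\qquad y(t)=y_0+\gamma\int_0^t\frac{ds}{x(s)}+\delta\int_0^t\frac{ds}{y(s)} .$$ Then the numbers $$C=2\alpha+\frac{\beta}{\delta}\Big(\beta-\gamma+\sqrt{(\beta-\gamma)^2+4\alpha\delta}\Big),\qquad D=2\delta+\frac{\gamma}{\alpha}\Big(\gamma-\beta+\sqrt{(\beta-\gamma)^2+4\alpha\delta}\Big)$$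 are positive and, with $c=\sqrt C$ and $d=\sqrt D$, the pair $x(t)=c\sqrt t$, $y(t)=d\sqrt t$ $(t\ge 0)$ is a solution starting at $(0,0)$, and it is the only one: every solution starting at $(0,0)$ equals $(c\sqrt t,d\sqrt t)$ for all $t\ge0$. -/

import Mathlib

open MeasureTheory

/-- `(x, y)` is a solution, started at `(x₀, y₀)`, of the integral system
`x(t) = x₀ + α ∫₀ᵗ ds/x(s) + β ∫₀ᵗ ds/y(s)`, `y(t) = y₀ + γ ∫₀ᵗ ds/x(s) + δ ∫₀ᵗ ds/y(s)`,
on the half-line `[0, ∞)` (values at negative times play no role).  Since `1 / 0 = 0` in Lean, the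
function `s ↦ 1 / x s` is `1_{x(s) > 0} / x(s)` on `[0, ∞)`, so that `integrable_x` says
`∫₀ᵗ 1_{x(s) > 0} ds/x(s) < ∞`; likewise for `y`. -/
structure IsQuadrantSolution (α β γ δ x₀ y₀ : ℝ) (x y : ℝ → ℝ) : Prop where
  continuousOn_x : ContinuousOn x (Set.Ici 0)
  continuousOn_y : ContinuousOn y (Set.Ici 0)
  nonneg_x : ∀ t, 0 ≤ t → 0 ≤ x t
  nonneg_y : ∀ t, 0 ≤ t → 0 ≤ y t
  null_x : ∀ t, 0 ≤ t → volume {s ∈ Set.Icc 0 t | x s = 0} = 0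
  null_y : ∀ t, 0 ≤ t → volume {s ∈ Set.Icc 0 t | y s = 0} = 0
  integrable_x : ∀ t, 0 ≤ t → IntervalIntegrable (fun s => 1 / x s) volume 0 t
  integrable_y : ∀ t, 0 ≤ t → IntervalIntegrable (fun s => 1 / y s) volume 0 t
  eq_x : ∀ t, 0 ≤ t → x t = x₀ + α * (∫ s in (0 : ℝ)..t, 1 / x s) + β * ∫ s in (0 : ℝ)..t, 1 / y s
  eq_y : ∀ t, 0 ≤ t → y t = y₀ + γ * (∫ s in (0 : ℝ)..t, 1 / x s) + δ * ∫ s in (0 : ℝ)..t, 1 / y s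

/-- The square of the constant `c` of the explicit solution `(c √t, d √t)`. -/
noncomputable def cornerCSq (α β γ δ : ℝ) : ℝ :=
  2 * α + β / δ * (β - γ + Real.sqrt ((β - γ) ^ 2 + 4 * α * δ))

/-- The square of the constant `d` of the explicit solution `(c √t, d √t)`. -/
noncomputable def cornerDSq (α β γ δ : ℝ) : ℝ :=
  2 * δ + γ / α * (γ - β + Real.sqrt ((β - γ) ^ 2 + 4 * α * δ))

/-- The first component `c √t` of the explicit solution started at the corner. -/
noncomputable def cornerX (α β γ δ : ℝ) (t : ℝ) : ℝ :=
  Real.sqrt (cornerCSq α β γ δ) * Real.sqrt t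

/-- The second component `d √t` of the explicit solution started at the corner. -/
noncomputable def cornerY (α β γ δ : ℝ) (t : ℝ) : ℝ :=
  Real.sqrt (cornerDSq α β γ δ) * Real.sqrt t

/-! ### Positivity at positive times -/

namespace IsQuadrantSolution

variable {α β γ δ x₀ y₀ : ℝ} {x y : ℝ → ℝ}

/-! A solution from the corner is positive for `t > 0` (`pos`), so `w = x / y` satisfies `w' = q(w)
/ (w y²)` with `q(w) = α + (β - γ) w - δ w²`. Its flow attracts to the positive root `ρ` of `q`, so
`w(t) > ρ` forces `w` to be larger still at earlier times. Starting at the corner excludes this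
(`ratio_le`): Rolle applied to `x - w(r) y` on `[0, r]` gives `s ≤ r` with `q(w(r)) + (β - δ w(r))
(w(s) - w(r)) = 0`. Since `q(w(r))` stays below a negative constant, `w` is bounded near `0`, and
then `r` with `w(r)` close to the supremum gives a contradiction. Exchanging coordinates yields `w =
ρ`, after which `x²` and `y²` have constant derivatives. -/

theorem swap (h : IsQuadrantSolution α β γ δ x₀ y₀ x y) :
    IsQuadrantSolution δ γ β α y₀ x₀ y x where
  continuousOn_x := h.continuousOn_y
  continuousOn_y := h.continuousOn_x
  nonneg_x := h.nonneg_y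
  nonneg_y := h.nonneg_x
  null_x := h.null_y
  null_y := h.null_x
  integrable_x := h.integrable_y
  integrable_y := h.integrable_x
  eq_x t ht := by rw [h.eq_y t ht]; ring
  eq_y t ht := by rw [h.eq_x t ht]; ring

/-- A solution has a positive first coordinate wherever its second coordinate is positive. -/
theorem pos_of_pos_snd (h : IsQuadrantSolution α β γ δ x₀ y₀ x y) (hα : 0 < α) {t : ℝ}
    (ht : 0 < t) (hy : 0 < y t) : 0 < x t := by
  refine lt_of_le_of_ne (h.nonneg_x t ht.le) fun hx => ?_
  have cx : ContinuousAt x t := h.continuousOn_x.continuousAt (Ici_mem_nhds ht)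
  have cy : ContinuousAt y t := h.continuousOn_y.continuousAt (Ici_mem_nhds ht)
  -- The last inequality makes the drift `α / x + β / y` nonnegative where `x > 0`, so `x` cannot
  -- decrease to `0` at `t`: it would vanish on a whole interval before `t`.
  have hev : ∀ᶠ s in nhds t, 0 < s ∧ 0 < y s ∧ |β| * x s < α * y s := by
    refine (lt_mem_nhds ht).and ((cy.eventually (lt_mem_nhds hy)).and ?_)
    refine Filter.Tendsto.eventually_lt (cx.const_mul |β|) (cy.const_mul α) ?_
    beta_reduce
    rw [← hx, mul_zero]
    positivity
  obtain ⟨ε, hε, hball⟩ := Metric.eventually_nhds_iff.1 hev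
  have hnear : ∀ s ∈ Set.Icc (t - ε / 2) t, 0 < s ∧ 0 < y s ∧ |β| * x s < α * y s := by
    intro s hs
    refine hball ?_
    rw [Real.dist_eq, abs_lt]
    constructor <;> linarith [hs.1, hs.2]
  have hzero : ∀ s ∈ Set.Icc (t - ε / 2) t, x s = 0 := by
    intro s hs
    have hs0 := (hnear s hs).1
    have ix := (h.integrable_x s hs0.le).symm.trans (h.integrable_x t ht.le)
    have iy := (h.integrable_y s hs0.le).symm.trans (h.integrable_y t ht.le)
    have ex := intervalIntegral.integral_interval_sub_left (h.integrable_x t ht.le)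
      (h.integrable_x s hs0.le)
    have ey := intervalIntegral.integral_interval_sub_left (h.integrable_y t ht.le)
      (h.integrable_y s hs0.le)
    have hsum : x t - x s = ∫ r in s..t, (α * (1 / x r) + β * (1 / y r)) := by
      rw [intervalIntegral.integral_add (ix.const_mul α) (iy.const_mul β),
        intervalIntegral.integral_const_mul, intervalIntegral.integral_const_mul, ← ex, ← ey,
        h.eq_x t ht.le, h.eq_x s hs0.le]
      ring
    have hnn : 0 ≤ ∫ r in s..t, (α * (1 / x r) + β * (1 / y r)) := by
      refine intervalIntegral.integral_nonneg_of_ae_restrict hs.2 ?_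
      have hae : ∀ᵐ r ∂volume, ¬ (r ∈ Set.Icc 0 t ∧ x r = 0) :=
        measure_eq_zero_iff_ae_notMem.1 (h.null_x t ht.le)
      filter_upwards [ae_restrict_of_ae hae, ae_restrict_mem measurableSet_Icc] with r hr hrI
      have hrn := hnear r ⟨hs.1.trans hrI.1, hrI.2⟩
      have hxr : 0 < x r := lt_of_le_of_ne (h.nonneg_x r hrn.1.le)
        fun h0 => hr ⟨⟨hrn.1.le, hrI.2⟩, h0.symm⟩
      have hb : -|β| * x r ≤ β * x r := mul_le_mul_of_nonneg_right (neg_abs_le β) hxr.le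
      have : α * (1 / x r) + β * (1 / y r) = (α * y r + β * x r) / (x r * y r) := by
        have := hrn.2.1.ne'
        field_simp
      simp only [Pi.zero_apply]
      rw [this]
      exact div_nonneg (by linarith [hrn.2.2]) (mul_pos hxr hrn.2.1).le
    linarith [h.nonneg_x s hs0.le]
  have hvol : volume (Set.Icc (t - ε / 2) t) ≤ volume {s ∈ Set.Icc 0 t | x s = 0} :=
    measure_mono fun s hs => ⟨⟨(hnear s hs).1.le, hs.2⟩, hzero s hs⟩
  rw [h.null_x t ht.le, Real.volume_Icc] at hvol
  have := ENNReal.ofReal_eq_zero.1 (le_antisymm hvol bot_le)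
  linarith

/-- Strictness comes from the zero set of `x` being null: there `1 / x` is `0` by convention. -/
theorem integral_inv_pos (h : IsQuadrantSolution α β γ δ x₀ y₀ x y) {t : ℝ} (ht : 0 < t) :
    0 < ∫ s in (0 : ℝ)..t, 1 / x s := by
  have hnn : ∀ᵐ s ∂volume.restrict (Set.Ioc 0 t), 0 ≤ 1 / x s := by
    filter_upwards [ae_restrict_mem measurableSet_Ioc] with s hs
    exact one_div_nonneg.2 (h.nonneg_x s hs.1.le)
  rw [intervalIntegral.integral_pos_iff_support_of_nonneg_ae'
    (by rwa [Set.uIoc_of_le ht.le]) (h.integrable_x t ht.le)]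
  refine ⟨ht, ?_⟩
  have hsub : Set.Ioc 0 t ⊆ (Function.support (fun s => 1 / x s) ∩ Set.Ioc 0 t) ∪
      {s ∈ Set.Icc 0 t | x s = 0} := by
    intro s hs
    by_cases hx : x s = 0
    · exact Or.inr ⟨⟨hs.1.le, hs.2⟩, hx⟩
    · exact Or.inl ⟨by simpa using hx, hs⟩
  have h1 := (measure_mono hsub).trans (measure_union_le (μ := volume) _ _)
  rw [h.null_x t ht.le, add_zero, Real.volume_Ioc] at h1
  exact lt_of_lt_of_le (by simpa using ht) h1

/-- A solution started at the corner is in the open quadrant at every positive time. -/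
theorem pos (h : IsQuadrantSolution α β γ δ 0 0 x y) (hα : 0 < α) (hδ : 0 < δ)
    (H : 0 ≤ max β γ ∨ β * γ < α * δ) {t : ℝ} (ht : 0 < t) : 0 < x t ∧ 0 < y t := by
  have hu := h.integral_inv_pos ht
  have hv := h.swap.integral_inv_pos ht
  have ex := h.eq_x t ht.le
  have ey := h.eq_y t ht.le
  have hx0 := h.nonneg_x t ht.le
  have hy0 := h.nonneg_y t ht.le
  have key : 0 < x t ∨ 0 < y t := by
    rcases le_or_gt 0 β with hβ | hβ
    · left
      rw [ex]
      have := mul_nonneg hβ hv.le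
      have := mul_pos hα hu
      linarith
    rcases le_or_gt 0 γ with hγ | hγ
    · right
      rw [ey]
      have := mul_nonneg hγ hu.le
      have := mul_pos hδ hv
      linarith
    have hdet : β * γ < α * δ := H.resolve_left (not_le.2 (max_lt hβ hγ))
    by_contra! hcon
    have hx : x t = 0 := le_antisymm hcon.1 hx0
    have hy : y t = 0 := le_antisymm hcon.2 hy0
    -- Eliminating `∫ 1/y` leaves the determinant as coefficient.
    have e : δ * x t - β * y t = (α * δ - β * γ) * ∫ s in (0 : ℝ)..t, 1 / x s := by
      rw [ex, ey]; ring
    rw [hx, hy, mul_zero, mul_zero, sub_zero] at e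
    exact (mul_pos (sub_pos.2 hdet) hu).ne e
  rcases key with hx | hy
  · exact ⟨hx, h.swap.pos_of_pos_snd hδ ht hx⟩
  · exact ⟨h.pos_of_pos_snd hα ht hy, hy⟩

/-! ### Dynamics of the ratio -/

theorem hasDerivAt_fst (h : IsQuadrantSolution α β γ δ x₀ y₀ x y)
    (hpos : ∀ t, 0 < t → 0 < x t ∧ 0 < y t) {t : ℝ} (ht : 0 < t) :
    HasDerivAt x (α / x t + β / y t) t := by
  have aux : ∀ f : ℝ → ℝ, ContinuousOn f (Set.Ici 0) → (∀ s, 0 < s → 0 < f s) →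
      IntervalIntegrable (fun s => 1 / f s) volume 0 t →
      HasDerivAt (fun r => ∫ s in (0 : ℝ)..r, 1 / f s) (1 / f t) t := by
    intro f hf hfpos hint
    have hc : ContinuousOn (fun s => 1 / f s) (Set.Ioi 0) :=
      continuousOn_const.div (hf.mono Set.Ioi_subset_Ici_self) fun s hs => (hfpos s hs).ne'
    exact intervalIntegral.integral_hasDerivAt_right hint
      (hc.stronglyMeasurableAtFilter isOpen_Ioi t ht) (hc.continuousAt (Ioi_mem_nhds ht))
  have hx := aux x h.continuousOn_x (fun s hs => (hpos s hs).1) (h.integrable_x t ht.le)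
  have hy := aux y h.continuousOn_y (fun s hs => (hpos s hs).2) (h.integrable_y t ht.le)
  have hsum := ((hx.const_mul α).const_add x₀).add (hy.const_mul β)
  have heq : x =ᶠ[nhds t] ((fun r => x₀ + α * ∫ s in (0 : ℝ)..r, 1 / x s) +
      fun r => β * ∫ s in (0 : ℝ)..r, 1 / y s) := by
    filter_upwards [Ioi_mem_nhds ht] with s hs
    exact h.eq_x s (le_of_lt hs)
  refine (hsum.congr_of_eventuallyEq heq).congr_deriv ?_
  ring

theorem hasDerivAt_snd (h : IsQuadrantSolution α β γ δ x₀ y₀ x y)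
    (hpos : ∀ t, 0 < t → 0 < x t ∧ 0 < y t) {t : ℝ} (ht : 0 < t) :
    HasDerivAt y (γ / x t + δ / y t) t := by
  refine (h.swap.hasDerivAt_fst (fun s hs => (hpos s hs).symm) ht).congr_deriv ?_
  ring

theorem map_zero (h : IsQuadrantSolution α β γ δ 0 0 x y) : x 0 = 0 ∧ y 0 = 0 :=
  ⟨by simpa using h.eq_x 0 le_rfl, by simpa using h.eq_y 0 le_rfl⟩

/-- Once the ratio `x / y` exceeds the positive root `ρ` of `α + (β - γ) w - δ w²`, it has been
decreasing since time zero. -/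
theorem ratio_antitone (h : IsQuadrantSolution α β γ δ x₀ y₀ x y)
    (hpos : ∀ t, 0 < t → 0 < x t ∧ 0 < y t) (hα : 0 < α) (hδ : 0 < δ) {ρ : ℝ} (hρ : 0 < ρ)
    (hroot : α + (β - γ) * ρ - δ * ρ ^ 2 = 0) {t : ℝ} (hw : ρ < x t / y t) :
    ∀ s r, 0 < s → s ≤ r → r ≤ t → x r / y r ≤ x s / y s := by
  have hd : ∀ s, 0 < s → HasDerivAt (fun s => (x s / y s - ρ) ^ 2)
      (-2 * (x s / y s - ρ) ^ 2 * (δ * ρ * x s + α * y s) / (ρ * x s * y s ^ 2)) s := by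
    intro s hs
    obtain ⟨hxs, hys⟩ := hpos s hs
    refine ((((h.hasDerivAt_fst hpos hs).div (h.hasDerivAt_snd hpos hs) hys.ne').sub_const
      ρ).pow 2).congr_deriv ?_
    -- Substituting for `β` amounts to the factorization `ρ q(w) = -(w - ρ) (α + δ ρ w)`.
    have hβ : β = γ + δ * ρ - α / ρ := by field_simp; linarith
    simp only [Pi.div_apply, Nat.cast_ofNat, Nat.add_one_sub_one, pow_one]
    rw [hβ]
    generalize x s = a at *
    generalize y s = b at *
    field_simp
    ring
  have hanti : AntitoneOn (fun s => (x s / y s - ρ) ^ 2) (Set.Ioi 0) := by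
    refine antitoneOn_of_deriv_nonpos (convex_Ioi 0)
      (fun s hs => (hd s hs).continuousAt.continuousWithinAt)
      (fun s hs => ?_) (fun s hs => ?_)
    · rw [interior_Ioi] at hs
      exact (hd s hs).differentiableAt.differentiableWithinAt
    · rw [interior_Ioi] at hs
      obtain ⟨hxs, hys⟩ := hpos s hs
      rw [(hd s hs).deriv]
      refine div_nonpos_of_nonpos_of_nonneg ?_ (by positivity)
      have : 0 ≤ (x s / y s - ρ) ^ 2 * (δ * ρ * x s + α * y s) := by positivity
      linarith
  -- Had `w` been at most `ρ` earlier, it would cross `ρ`, and the antitone square would stay `0`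
  -- from then on.
  have hgt : ∀ s, 0 < s → s ≤ t → ρ < x s / y s := by
    intro s hs hst
    by_contra! hle
    have hcont : ContinuousOn (fun s => x s / y s) (Set.Icc s t) := fun r hr => by
      have hr0 := hs.trans_le hr.1
      exact ((h.hasDerivAt_fst hpos hr0).continuousAt.div
        (h.hasDerivAt_snd hpos hr0).continuousAt (hpos r hr0).2.ne').continuousWithinAt
    obtain ⟨r, hr, hrρ⟩ := intermediate_value_Icc hst hcont ⟨hle, hw.le⟩
    have hrρ' : x r / y r = ρ := hrρ
    have := hanti (Set.mem_Ioi.2 (hs.trans_le hr.1)) (Set.mem_Ioi.2 (hs.trans_le hst)) hr.2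
    simp only [hrρ', sub_self] at this
    nlinarith [sub_pos.2 hw]
  intro s r hs hsr hrt
  have h1 := hanti (Set.mem_Ioi.2 hs) (Set.mem_Ioi.2 (hs.trans_le hsr)) hsr
  have h2 := hgt s hs (hsr.trans hrt)
  have h3 := abs_le_of_sq_le_sq h1 (sub_pos.2 h2).le
  linarith [le_abs_self (x r / y r - ρ)]

/-- The ratio `x / y` of a solution started at the corner never exceeds the positive root `ρ`. -/
theorem ratio_le (h : IsQuadrantSolution α β γ δ 0 0 x y)
    (hpos : ∀ t, 0 < t → 0 < x t ∧ 0 < y t) (hα : 0 < α) (hδ : 0 < δ) {ρ : ℝ} (hρ : 0 < ρ)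
    (hroot : α + (β - γ) * ρ - δ * ρ ^ 2 = 0) {t : ℝ} (ht : 0 < t) : x t / y t ≤ ρ := by
  by_contra! hw
  have hanti := h.ratio_antitone hpos hα hδ hρ hroot hw
  -- `q` decreases to the right of `ρ`.
  have hneg : ∀ k, x t / y t ≤ k →
      α + (β - γ) * k - δ * k ^ 2 ≤ α + (β - γ) * (x t / y t) - δ * (x t / y t) ^ 2 := by
    intro k hk
    generalize x t / y t = w at *
    have h1 : β - γ = δ * ρ - α / ρ := by field_simp; linarith
    have h2 : 0 < α / ρ := by positivity
    rw [h1]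
    nlinarith [mul_nonneg (sub_nonneg.2 hk) h2.le,
      mul_nonneg (mul_nonneg (sub_nonneg.2 hk) hδ.le) (by linarith : 0 ≤ k + w - ρ)]
  have hq : α + (β - γ) * (x t / y t) - δ * (x t / y t) ^ 2 < 0 := by
    generalize x t / y t = w at *
    have : ρ * (α + (β - γ) * w - δ * w ^ 2) = -(w - ρ) * (α + δ * ρ * w) := by
      linear_combination w * hroot
    have h3 : 0 < (w - ρ) * (α + δ * ρ * w) :=
      mul_pos (sub_pos.2 hw) (by have := hρ.trans hw; positivity)
    by_contra! hc
    have := mul_nonneg hρ.le hc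
    linarith
  -- by Rolle, `x - (x r / y r) y`, which vanishes at `0` and `r`, has a critical point
  have hcrit : ∀ r, 0 < r → r ≤ t → ∃ s, 0 < s ∧ s ≤ r ∧
      (α - x r / y r * γ) + (β - x r / y r * δ) * (x s / y s) = 0 := by
    intro r hr hrt
    have hyr := (hpos r hr).2
    obtain ⟨s, hs, hsl⟩ := exists_hasDerivAt_eq_slope (fun s => x s - x r / y r * y s)
      (fun s => (α / x s + β / y s) - x r / y r * (γ / x s + δ / y s)) hr
      ((h.continuousOn_x.mono Set.Icc_subset_Ici_self).sub
        ((h.continuousOn_y.mono Set.Icc_subset_Ici_self).const_mul _))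
      (fun s hs => (h.hasDerivAt_fst hpos hs.1).sub ((h.hasDerivAt_snd hpos hs.1).const_mul _))
    obtain ⟨hxs, hys⟩ := hpos s hs.1
    refine ⟨s, hs.1, hs.2.le, ?_⟩
    have h0 : x r - x r / y r * y r - (x 0 - x r / y r * y 0) = 0 := by
      rw [h.map_zero.1, h.map_zero.2]
      field_simp
      ring
    rw [h0, zero_div] at hsl
    calc _ = x s * ((α / x s + β / y s) - x r / y r * (γ / x s + δ / y s)) := by
          generalize x r / y r = k
          field_simp
          ring
      _ = 0 := by rw [hsl, mul_zero]
  have hslope : ∀ r, 0 < r → r ≤ t → x r / y r * δ < β := by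
    intro r hr hrt
    by_contra! hle
    obtain ⟨s, hs, hsr, he⟩ := hcrit r hr hrt
    have h1 := hneg _ (hanti r t hr hrt le_rfl)
    have h2 := hanti s r hs hsr hrt
    nlinarith [mul_nonneg (sub_nonneg.2 hle) (sub_nonneg.2 h2)]
  have hwpos : 0 < x t / y t := hρ.trans hw
  have hβ : 0 < β := lt_trans (mul_pos hwpos hδ) (hslope t ht le_rfl)
  have hbdd : BddAbove ((fun s => x s / y s) '' Set.Ioc 0 t) := by
    refine ⟨β / δ, ?_⟩
    rintro _ ⟨s, hs, rfl⟩
    exact (le_div_iff₀ hδ).2 (hslope s hs.1 hs.2).le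
  set M := sSup ((fun s => x s / y s) '' Set.Ioc 0 t)
  set q := α + (β - γ) * (x t / y t) - δ * (x t / y t) ^ 2
  -- The margin `-q / β` makes `β (w(s) - w(r)) < -q`, whereas the critical point equation needs at
  -- least `-q`.
  obtain ⟨_, ⟨r, hr, rfl⟩, hrM⟩ := exists_lt_of_lt_csSup
    (Set.Nonempty.image (fun s => x s / y s) (s := Set.Ioc 0 t) ⟨t, ht, le_rfl⟩)
    (show M + q / β < M by have := div_neg_of_neg_of_pos hq hβ; linarith)
  obtain ⟨s, hs, hsr, he⟩ := hcrit r hr.1 hr.2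
  have h1 := hneg _ (hanti r t hr.1 hr.2 le_rfl)
  have h2 := hanti s r hs hsr hr.2
  have h3 : x s / y s ≤ M := le_csSup hbdd ⟨s, ⟨hs, hsr.trans hr.2⟩, rfl⟩
  have hk : 0 < x r / y r := div_pos (hpos r hr.1).1 (hpos r hr.1).2
  have h4 : β * (x s / y s - x r / y r) < -q := by
    have : β * (x s / y s - x r / y r) < β * (-(q / β)) :=
      mul_lt_mul_of_pos_left (by simp only at hrM; linarith) hβ
    have e : β * (-(q / β)) = -q := by field_simp
    linarith
  nlinarith [mul_nonneg (mul_pos hk hδ).le (sub_nonneg.2 h2)]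

/-- If `x / y` is constant, then `x` is a multiple of the square root. -/
theorem sq_eq_of_ratio_eq (h : IsQuadrantSolution α β γ δ 0 0 x y)
    (hpos : ∀ t, 0 < t → 0 < x t ∧ 0 < y t) {ρ : ℝ} (hr : ∀ t, 0 < t → x t / y t = ρ)
    {t : ℝ} (ht : 0 < t) : x t ^ 2 = (2 * α + 2 * β * ρ) * t := by
  obtain ⟨s, hs, hsl⟩ := exists_hasDerivAt_eq_slope (fun s => x s ^ 2) _ ht
    ((h.continuousOn_x.mono Set.Icc_subset_Ici_self).pow 2)
    (fun s hs => (h.hasDerivAt_fst hpos hs.1).pow 2)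
  obtain ⟨hxs, hys⟩ := hpos s hs.1
  rw [h.map_zero.1, eq_div_iff (by linarith)] at hsl
  rw [← hr s hs.1]
  have e : 2 * α + 2 * β * (x s / y s) = ((2 : ℕ) : ℝ) * x s ^ (2 - 1) * (α / x s + β / y s) := by
    push_cast
    field_simp
  rw [e]
  linarith

end IsQuadrantSolution

/-! ### The constants and the explicit solution -/

/-- The positive root of `α + (β - γ) w - δ w²`, which is the slope `c / d`. -/
noncomputable def cornerRatio (α β γ δ : ℝ) : ℝ :=
  (β - γ + Real.sqrt ((β - γ) ^ 2 + 4 * α * δ)) / (2 * δ)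

section Corner

variable {α β γ δ : ℝ}

theorem abs_sub_lt_sqrt_discr (hα : 0 < α) (hδ : 0 < δ) :
    |β - γ| < Real.sqrt ((β - γ) ^ 2 + 4 * α * δ) := by
  rw [← Real.sqrt_sq_eq_abs]
  exact Real.sqrt_lt_sqrt (sq_nonneg _) (by have := mul_pos hα hδ; linarith)

theorem sq_sqrt_discr (hα : 0 < α) (hδ : 0 < δ) :
    Real.sqrt ((β - γ) ^ 2 + 4 * α * δ) ^ 2 = (β - γ) ^ 2 + 4 * α * δ :=
  Real.sq_sqrt (by positivity)

theorem cornerRatio_pos (hα : 0 < α) (hδ : 0 < δ) : 0 < cornerRatio α β γ δ :=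
  div_pos (by linarith [(abs_lt.1 (abs_sub_lt_sqrt_discr (β := β) (γ := γ) hα hδ)).1])
    (by positivity)

theorem cornerRatio_root (hα : 0 < α) (hδ : 0 < δ) :
    α + (β - γ) * cornerRatio α β γ δ - δ * cornerRatio α β γ δ ^ 2 = 0 := by
  have h := sq_sqrt_discr (β := β) (γ := γ) hα hδ
  unfold cornerRatio
  generalize Real.sqrt ((β - γ) ^ 2 + 4 * α * δ) = S at h
  field_simp
  linarith

theorem cornerRatio_swap (hα : 0 < α) (hδ : 0 < δ) :
    cornerRatio δ γ β α = (cornerRatio α β γ δ)⁻¹ := by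
  have h := sq_sqrt_discr (β := β) (γ := γ) hα hδ
  have hp := (abs_lt.1 (abs_sub_lt_sqrt_discr (β := β) (γ := γ) hα hδ)).1
  unfold cornerRatio
  rw [show (γ - β) ^ 2 + 4 * δ * α = (β - γ) ^ 2 + 4 * α * δ by ring, inv_div]
  generalize Real.sqrt ((β - γ) ^ 2 + 4 * α * δ) = S at h hp
  have : β - γ + S ≠ 0 := by linarith
  rw [div_eq_div_iff (by positivity) this]
  linarith

theorem cornerCSq_eq (hδ : 0 < δ) :
    cornerCSq α β γ δ = 2 * α + 2 * β * cornerRatio α β γ δ := by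
  unfold cornerCSq cornerRatio
  field_simp

theorem cornerDSq_eq_cornerCSq_swap : cornerDSq α β γ δ = cornerCSq δ γ β α := by
  unfold cornerDSq cornerCSq
  rw [show (γ - β) ^ 2 + 4 * δ * α = (β - γ) ^ 2 + 4 * α * δ by ring]

theorem cornerDSq_eq (hα : 0 < α) (hδ : 0 < δ) :
    cornerDSq α β γ δ = 2 * δ + 2 * γ * (cornerRatio α β γ δ)⁻¹ := by
  rw [cornerDSq_eq_cornerCSq_swap, cornerCSq_eq hα, cornerRatio_swap hα hδ]

theorem cornerCSq_eq_sq_mul (hα : 0 < α) (hδ : 0 < δ) :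
    cornerCSq α β γ δ = cornerRatio α β γ δ ^ 2 * cornerDSq α β γ δ := by
  have h := cornerRatio_root (β := β) (γ := γ) hα hδ
  have hp := cornerRatio_pos (β := β) (γ := γ) hα hδ
  rw [cornerCSq_eq hδ, cornerDSq_eq hα hδ]
  field_simp
  linarith

theorem cornerCSq_pos (hα : 0 < α) (hδ : 0 < δ) (H : 0 ≤ max β γ ∨ β * γ < α * δ) :
    0 < cornerCSq α β γ δ := by
  have h := sq_sqrt_discr (β := β) (γ := γ) hα hδ
  obtain ⟨h1, h2⟩ := abs_lt.1 (abs_sub_lt_sqrt_discr (β := β) (γ := γ) hα hδ)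
  unfold cornerCSq
  generalize Real.sqrt ((β - γ) ^ 2 + 4 * α * δ) = S at h h1 h2
  -- In the second case of `H`, use `S² - (β + γ)² = 4 (αδ - βγ)`.
  have hS : 0 < S + β + γ := by
    rcases H with H | H
    · rcases le_max_iff.1 H with H | H <;> linarith
    · by_contra! hc
      nlinarith
  have e : (2 * α + β / δ * (β - γ + S)) * (S - (β - γ)) = 2 * α * (S + β + γ) := by
    field_simp
    linear_combination β * h
  have : 0 < (2 * α + β / δ * (β - γ + S)) * (S - (β - γ)) := by rw [e]; positivity
  exact pos_of_mul_pos_left this (by linarith)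

theorem cornerDSq_pos (hα : 0 < α) (hδ : 0 < δ) (H : 0 ≤ max β γ ∨ β * γ < α * δ) :
    0 < cornerDSq α β γ δ := by
  rw [cornerDSq_eq_cornerCSq_swap]
  exact cornerCSq_pos hδ hα (by rwa [max_comm, mul_comm γ, mul_comm δ])

theorem sqrt_cornerCSq (hα : 0 < α) (hδ : 0 < δ) :
    Real.sqrt (cornerCSq α β γ δ) = cornerRatio α β γ δ * Real.sqrt (cornerDSq α β γ δ) := by
  rw [cornerCSq_eq_sq_mul hα hδ, Real.sqrt_mul (sq_nonneg _),
    Real.sqrt_sq (cornerRatio_pos hα hδ).le]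

/-- At `s = 0` both sides are `0` by convention. -/
theorem one_div_mul_sqrt (c s : ℝ) (hs : 0 ≤ s) :
    1 / (c * Real.sqrt s) = c⁻¹ * s ^ (-(1 / 2) : ℝ) := by
  rw [one_div, mul_inv, Real.rpow_neg hs, ← Real.sqrt_eq_rpow]

theorem intervalIntegrable_one_div_mul_sqrt (c : ℝ) {t : ℝ} (ht : 0 ≤ t) :
    IntervalIntegrable (fun s => 1 / (c * Real.sqrt s)) volume 0 t := by
  refine ((intervalIntegral.intervalIntegrable_rpow' (a := 0) (b := t)
    (by norm_num : (-1 : ℝ) < -(1 / 2))).const_mul c⁻¹).congr ?_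
  intro s hs
  rw [Set.uIoc_of_le ht] at hs
  exact (one_div_mul_sqrt c s hs.1.le).symm

theorem integral_one_div_mul_sqrt (c : ℝ) {t : ℝ} (ht : 0 ≤ t) :
    ∫ s in (0 : ℝ)..t, 1 / (c * Real.sqrt s) = 2 * Real.sqrt t / c := by
  have : ∫ s in (0 : ℝ)..t, 1 / (c * Real.sqrt s) =
      ∫ s in (0 : ℝ)..t, c⁻¹ * s ^ (-(1 / 2) : ℝ) := by
    refine intervalIntegral.integral_congr fun s hs => ?_
    rw [Set.uIcc_of_le ht] at hs
    exact one_div_mul_sqrt c s hs.1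
  rw [this, intervalIntegral.integral_const_mul,
    integral_rpow (Or.inl (by norm_num : (-1 : ℝ) < -(1 / 2)))]
  norm_num
  rw [Real.sqrt_eq_rpow]
  ring

theorem volume_mul_sqrt_eq_zero {c : ℝ} (hc : 0 < c) (t : ℝ) :
    volume {s ∈ Set.Icc 0 t | c * Real.sqrt s = 0} = 0 := by
  refine measure_mono_null (t := {0}) ?_ Real.volume_singleton
  rintro s ⟨hs, h0⟩
  exact (Real.sqrt_eq_zero hs.1).1 ((mul_eq_zero.1 h0).resolve_left hc.ne')

theorem isQuadrantSolution_corner (hα : 0 < α) (hδ : 0 < δ)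
    (H : 0 ≤ max β γ ∨ β * γ < α * δ) :
    IsQuadrantSolution α β γ δ 0 0 (cornerX α β γ δ) (cornerY α β γ δ) := by
  have hC := cornerCSq_pos hα hδ H
  have hD := cornerDSq_pos hα hδ H
  have hc := Real.sqrt_pos.2 hC
  have hd := Real.sqrt_pos.2 hD
  have hcsq := Real.sq_sqrt hC.le
  have hdsq := Real.sq_sqrt hD.le
  have hρ := cornerRatio_pos (β := β) (γ := γ) hα hδ
  have hcd := sqrt_cornerCSq (β := β) (γ := γ) hα hδ
  have hCe := cornerCSq_eq (α := α) (β := β) (γ := γ) hδ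
  have hDe := cornerDSq_eq (β := β) (γ := γ) hα hδ
  unfold cornerX cornerY
  rw [← hcsq] at hCe
  rw [← hdsq] at hDe
  generalize Real.sqrt (cornerCSq α β γ δ) = c at *
  generalize Real.sqrt (cornerDSq α β γ δ) = d at *
  generalize cornerRatio α β γ δ = ρ at *
  have e1 : c = 2 * α / c + 2 * β / d := by
    have : c * c = c * (2 * α / c + 2 * β / d) := by
      rw [← sq, hCe, hcd]
      field_simp
    exact mul_left_cancel₀ hc.ne' this
  have e2 : d = 2 * γ / c + 2 * δ / d := by
    have : d * d = d * (2 * γ / c + 2 * δ / d) := by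
      rw [← sq, hDe, hcd]
      field_simp
      ring
    exact mul_left_cancel₀ hd.ne' this
  refine ⟨by fun_prop, by fun_prop, fun t _ => by positivity, fun t _ => by positivity,
    fun t _ => volume_mul_sqrt_eq_zero hc t, fun t _ => volume_mul_sqrt_eq_zero hd t,
    fun t ht => intervalIntegrable_one_div_mul_sqrt c ht,
    fun t ht => intervalIntegrable_one_div_mul_sqrt d ht, fun t ht => ?_, fun t ht => ?_⟩
  · rw [integral_one_div_mul_sqrt c ht, integral_one_div_mul_sqrt d ht]
    linear_combination Real.sqrt t * e1
  · rw [integral_one_div_mul_sqrt c ht, integral_one_div_mul_sqrt d ht]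
    linear_combination Real.sqrt t * e2

theorem eq_sqrt_mul_sqrt {a C t : ℝ} (ha : 0 ≤ a) (hC : 0 ≤ C) (h : a ^ 2 = C * t) :
    a = Real.sqrt C * Real.sqrt t := by
  rw [← Real.sqrt_mul hC, ← h, Real.sqrt_sq ha]

end Corner

/-! ### Existence and uniqueness -/

theorem mainTheorem2 (α β γ δ : ℝ) (hα : 0 < α) (hδ : 0 < δ)
    (H : 0 ≤ max β γ ∨ β * γ < α * δ) :
    (0 < cornerCSq α β γ δ ∧ 0 < cornerDSq α β γ δ) ∧
    IsQuadrantSolution α β γ δ 0 0 (cornerX α β γ δ) (cornerY α β γ δ) ∧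
    ∀ x y : ℝ → ℝ, IsQuadrantSolution α β γ δ 0 0 x y →
      ∀ t, 0 ≤ t → x t = cornerX α β γ δ t ∧ y t = cornerY α β γ δ t := by

  have hC := cornerCSq_pos hα hδ H
  have hD := cornerDSq_pos hα hδ H
  refine ⟨⟨hC, hD⟩, isQuadrantSolution_corner hα hδ H, fun x y h t ht => ?_⟩
  rcases ht.eq_or_lt with rfl | ht
  · simp [cornerX, cornerY, h.map_zero]
  have hpos : ∀ s, 0 < s → 0 < x s ∧ 0 < y s := fun s hs => h.pos hα hδ H hs
  have hpos' : ∀ s, 0 < s → 0 < y s ∧ 0 < x s := fun s hs => (hpos s hs).symm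
  have hratio : ∀ s, 0 < s → x s / y s = cornerRatio α β γ δ := by
    intro s hs
    refine le_antisymm
      (h.ratio_le hpos hα hδ (cornerRatio_pos hα hδ) (cornerRatio_root hα hδ) hs) ?_
    have := h.swap.ratio_le hpos' hδ hα (cornerRatio_pos hδ hα) (cornerRatio_root hδ hα) hs
    rw [cornerRatio_swap hα hδ, ← inv_div] at this
    exact (inv_le_inv₀ (div_pos (hpos s hs).1 (hpos s hs).2) (cornerRatio_pos hα hδ)).1 this
  have hratio' : ∀ s, 0 < s → y s / x s = (cornerRatio α β γ δ)⁻¹ := fun s hs => by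
    rw [← hratio s hs, inv_div]
  refine ⟨eq_sqrt_mul_sqrt (hpos t ht).1.le hC.le ?_, eq_sqrt_mul_sqrt (hpos t ht).2.le hD.le ?_⟩
  · rw [cornerCSq_eq hδ]
    exact h.sq_eq_of_ratio_eq hpos hratio ht
  · rw [cornerDSq_eq hα hδ]
    exact h.swap.sq_eq_of_ratio_eq hpos' hratio' ht
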